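/- Let $K$ be a field of characteristic $0$ (for instance $\mathbb R$ or $\mathbb C$) and let $\mathfrak a$ be a finite-dimensional Lie algebra over $K$ with basis $e_i$ and structure constants $[e_i,e_j]=\sum_k C_{ij}^k e_k$; write $\xi_i$ for the corresponding linear coordinates on $\mathfrak a^*$. Let $$\Omega_{ij}(\xi)=\sum_k \xi_k\,C_{ij}^k+\sum_{k,l}\xi_k\xi_l\,C_{ij}^{kl}+\dots\in K[[\xi]]$$ be the matrix of a formal Poisson bracket on $\mathfrak a^*$ at the origin, i.e. formal power series without constant term and with linear part $\sum_k\xi_kC_{ij}^k$ such that the bracket $$\{F,G\}=\sum_{i,j}\frac{\partial F}{\partial \xi_i}\,\Omega_{ij}\,\frac{\partial G}{\partial \xi_j},\qquad F,G\in K[[\xi]],$$ is skew-symmetric and satisfies the Jacobi identity. Let $S\mathfrak a$ be the symmetric algebra of $\mathfrak a$, on which $\mathfrak a$ acts by the derivations extending the adjoint action. If the second Lie algebra cohomology group $H^2(\mathfrak a,S\mathfrak a)$ vanishes, then $\Omega$ can be reduced to its linear part $\sum_k\xi_kC_{ij}^k$ (the Berezin–Kirillov, or Lie–Poisson, bracket)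 by a formal change of variables $\xi_i\mapsto f_i(\xi)$: there are formal power series $f_i\in K[[\xi]]$ with $f_i(0)=0$ and invertible Jacobian matrix $\bigl(\partial f_i/\partial\xi_j(0)\bigr)$ such that for all $i,j$ $$\{f_i,f_j\}=\sum_k C_{ij}^k\,f_k .$$ -/

import Mathlib

set_option maxSynthPendingDepth 3

noncomputable section

namespace SymmetricAlgebra

variable {K L : Type*} [CommRing K] [LieRing L] [LieAlgebra K L]

/-- The algebra homomorphism `S(L) → S(L) ⊕ ε S(L)`, `y ↦ y + ε ⁅x, y⁆` on generators. -/
def adjointLift (x : L) :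
    SymmetricAlgebra K L →ₐ[K] TrivSqZeroExt (SymmetricAlgebra K L) (SymmetricAlgebra K L) :=
  lift ((TrivSqZeroExt.inlAlgHom K (SymmetricAlgebra K L) (SymmetricAlgebra K L)).toLinearMap ∘ₗ
      ι K L +
    (TrivSqZeroExt.inrHom (SymmetricAlgebra K L) (SymmetricAlgebra K L)).restrictScalars K ∘ₗ
      ι K L ∘ₗ (LieAlgebra.ad K L x : L →ₗ[K] L))

theorem adjointLift_ι (x y : L) :
    adjointLift (K := K) x (ι K L y) =
      TrivSqZeroExt.inl (ι K L y) + TrivSqZeroExt.inr (ι K L ⁅x, y⁆) := by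
  simp [adjointLift]

theorem fst_adjointLift (x : L) (a : SymmetricAlgebra K L) :
    TrivSqZeroExt.fst (adjointLift x a) = a := by
  have h : (TrivSqZeroExt.fstHom K (SymmetricAlgebra K L) (SymmetricAlgebra K L)).comp
      (adjointLift x) = AlgHom.id K _ := by
    apply algHom_ext
    ext y
    simp [adjointLift_ι]
  exact DFunLike.congr_fun h a

/-- The adjoint action of `x` on the symmetric algebra: the unique derivation of `S(L)` that maps
a generator `y` to `⁅x, y⁆`. -/
def adjointDerivation (x : L) : Derivation K (SymmetricAlgebra K L) (SymmetricAlgebra K L) :=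
  Derivation.mk'
    ((TrivSqZeroExt.sndHom (SymmetricAlgebra K L) (SymmetricAlgebra K L)).restrictScalars K ∘ₗ
      (adjointLift x).toLinearMap)
    (fun a b => by
      simp [TrivSqZeroExt.snd_mul, fst_adjointLift, mul_comm])

@[simp]
theorem adjointDerivation_ι (x y : L) :
    adjointDerivation (K := K) x (ι K L y) = ι K L ⁅x, y⁆ := by
  simp [adjointDerivation, adjointLift_ι]

theorem derivation_ext {D₁ D₂ : Derivation K (SymmetricAlgebra K L) (SymmetricAlgebra K L)}
    (h : ∀ y : L, D₁ (ι K L y) = D₂ (ι K L y)) : D₁ = D₂ := by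
  ext a
  induction a using SymmetricAlgebra.induction with
  | algebraMap r => simp
  | ι y => exact h y
  | mul a b ha hb => simp [ha, hb]
  | add a b ha hb => simp [ha, hb]

variable (K L) in
/-- The adjoint action as a homomorphism of Lie algebras `L → Der S(L)`. -/
def adjointHom : L →ₗ⁅K⁆ Derivation K (SymmetricAlgebra K L) (SymmetricAlgebra K L) where
  toFun := adjointDerivation
  map_add' x y := derivation_ext fun z => by simp
  map_smul' r x := derivation_ext fun z => by simp
  map_lie' {x y} := derivation_ext fun z => by simp [Derivation.commutator_apply]

/-- `S(L)` as an `L`-module, the action being by derivations extending the adjoint action. -/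
instance : LieRingModule L (SymmetricAlgebra K L) where
  bracket x a := adjointHom K L x a
  add_lie x y a := by simp
  lie_add x a b := by simp
  leibniz_lie x y a := by simp [Derivation.commutator_apply]

theorem lie_def (x : L) (a : SymmetricAlgebra K L) : ⁅x, a⁆ = adjointDerivation x a := rfl

instance : LieModule K L (SymmetricAlgebra K L) where
  smul_lie r x a := by
    change adjointHom K L (r • x) a = r • adjointHom K L x a
    simp
  lie_smul r x a := by simp [lie_def]

end SymmetricAlgebra

/-- The second Lie algebra cohomology `H²(L, M)`: Chevalley–Eilenberg 2-cocycles modulo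
2-coboundaries. -/
abbrev LieSecondCohomology (K L M : Type*) [CommRing K] [LieRing L] [LieAlgebra K L]
    [AddCommGroup M] [Module K M] [LieRingModule L M] [LieModule K L M] : Type _ :=
  LieModule.Cohomology.twoCocycle K L M ⧸
    (LinearMap.range (LieModule.Cohomology.d₁₂ K L M)).submoduleOf
      (LieModule.Cohomology.twoCocycle K L M)

namespace FormalPoisson

variable {K ι : Type*} [Field K] [Fintype ι]

/-- The bracket `{F, G} = ∑ᵢⱼ (∂F/∂ξᵢ) Ωᵢⱼ (∂G/∂ξⱼ)` with matrix `Ω` on formal power series in the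
coordinates `ξᵢ`. -/
def bracket (Ω : ι → ι → MvPowerSeries ι K) (F G : MvPowerSeries ι K) : MvPowerSeries ι K :=
  ∑ i, ∑ j, MvPowerSeries.pderiv K i F * Ω i j * MvPowerSeries.pderiv K j G

/-- `Ω` is the matrix of a formal Poisson bracket: the bracket is skew-symmetric and satisfies the
Jacobi identity (it is a derivation in each argument by its very form). -/
structure IsPoissonMatrix (Ω : ι → ι → MvPowerSeries ι K) : Prop where
  skew : ∀ F G, bracket Ω F G = -bracket Ω G F
  jacobi : ∀ F G H, bracket Ω F (bracket Ω G H) =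
    bracket Ω (bracket Ω F G) H + bracket Ω G (bracket Ω F H)

/-- The structure constants `Cᵢⱼᵏ` of `L` in the basis `b`: `⁅bᵢ, bⱼ⁆ = ∑ₖ Cᵢⱼᵏ bₖ`. -/
def structureConstant {L : Type*} [LieRing L] [LieAlgebra K L] (b : Module.Basis ι K L)
    (i j k : ι) : K :=
  b.repr ⁅b i, b j⁆ k

/-- `Ωᵢⱼ(ξ) = ∑ₖ Cᵢⱼᵏ ξₖ + (terms of degree ≥ 2)`: the expansion of `Ω` starts with the matrix of
the Berezin–Kirillov (Lie–Poisson) bracket. -/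
def HasLiePoissonLinearPart {L : Type*} [LieRing L] [LieAlgebra K L] (b : Module.Basis ι K L)
    (Ω : ι → ι → MvPowerSeries ι K) : Prop :=
  ∀ i j, MvPowerSeries.constantCoeff (Ω i j) = 0 ∧
    ∀ k, MvPowerSeries.coeff (Finsupp.single k 1) (Ω i j) = structureConstant b i j k

/-- `ξᵢ ↦ fᵢ(ξ)` is a formal change of variables at the origin: no constant terms, and the
Jacobian matrix at the origin is invertible. -/
def IsFormalChangeOfVariables [DecidableEq ι] (f : ι → MvPowerSeries ι K) : Prop :=
  (∀ i, MvPowerSeries.constantCoeff (f i) = 0) ∧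
    IsUnit (Matrix.of fun i j : ι => MvPowerSeries.coeff (Finsupp.single j 1) (f i))

end FormalPoisson

end

noncomputable section

namespace FormalPoisson

open MvPowerSeries

/-! ### The order filtration on power series -/

variable {K ι : Type*} [Field K]

/-! A linearizing change of variables amounts to a linear map `φ : L → K[[ξ]]`, tangent to the
coordinates, that is a Lie homomorphism for the bracket. It is built degree by degree. If the defect
{φ x, φ y} - φ[x, y] starts in degree n + 2, the Jacobi identity makes its leading part a 2-cocycle
with values in S(L), since to lowest order {φ x, ·} is the action of x
(`bracket_sub_coadjointDerivation_mem`, `homDefect_jacobi`). By H² = 0 this cocycle is a coboundary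
dα. Subtracting the degree n + 2 part of α from φ pushes the defect to degree n + 3
(`exists_correction`). The corrections have growing degree, so they converge formally, and the limit
has zero defect. -/

variable (K ι) in
/-- The power series all of whose terms have degree at least `n`. -/
def degreeGE (n : ℕ) : Submodule K (MvPowerSeries ι K) where
  carrier := {F | ∀ d, Finsupp.degree d < n → coeff d F = 0}
  add_mem' {F G} hF hG d hd := by simp [hF d hd, hG d hd]
  zero_mem' := by simp
  smul_mem' c F hF d hd := by simp [hF d hd]

theorem mem_degreeGE_iff_le_order {n : ℕ} {F : MvPowerSeries ι K} :
    F ∈ degreeGE K ι n ↔ (n : ℕ∞) ≤ F.order :=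
  ⟨fun h => nat_le_order h, fun h d hd =>
    coeff_of_lt_order (lt_of_lt_of_le (by exact_mod_cast hd) h)⟩

theorem degreeGE_anti {m n : ℕ} (h : m ≤ n) {F : MvPowerSeries ι K} (hF : F ∈ degreeGE K ι n) :
    F ∈ degreeGE K ι m :=
  fun d hd => hF d (hd.trans_le h)

theorem mul_mem_degreeGE {m n : ℕ} {F G : MvPowerSeries ι K} (hF : F ∈ degreeGE K ι m)
    (hG : G ∈ degreeGE K ι n) : F * G ∈ degreeGE K ι (m + n) := by
  rw [mem_degreeGE_iff_le_order] at *
  push_cast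
  exact (add_le_add hF hG).trans le_order_mul

theorem pderiv_mem_degreeGE {n : ℕ} {F : MvPowerSeries ι K} (hF : F ∈ degreeGE K ι (n + 1))
    (i : ι) : pderiv K i F ∈ degreeGE K ι n := fun d hd => by
  rw [coeff_pderiv, hF, zero_mul]
  simpa using hd

theorem eq_zero_of_forall_mem_degreeGE {F : MvPowerSeries ι K} (h : ∀ n, F ∈ degreeGE K ι n) :
    F = 0 := by
  ext d
  exact h _ d (Nat.lt_succ_self _)

theorem homogeneousComponent_mem_degreeGE (n : ℕ) (F : MvPowerSeries ι K) :
    homogeneousComponent n F ∈ degreeGE K ι n := fun d hd => by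
  rw [coeff_homogeneousComponent, if_neg hd.ne]

theorem homogeneousComponent_eq_zero {n : ℕ} {F : MvPowerSeries ι K}
    (hF : F ∈ degreeGE K ι (n + 1)) : homogeneousComponent n F = 0 := by
  ext d
  rw [coeff_homogeneousComponent]
  split_ifs with h
  · exact hF d (by omega)
  · simp

theorem sub_homogeneousComponent_mem {n : ℕ} {F : MvPowerSeries ι K} (hF : F ∈ degreeGE K ι n) :
    F - homogeneousComponent n F ∈ degreeGE K ι (n + 1) := fun d hd => by
  rw [map_sub, coeff_homogeneousComponent]
  split_ifs with h
  · simp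
  · simpa using hF d (by omega)

theorem homogeneousComponent_X_mul_pderiv (n : ℕ) (i j : ι) (F : MvPowerSeries ι K) :
    homogeneousComponent n (X i * pderiv K j F) =
      X i * pderiv K j (homogeneousComponent n F) := by
  classical
  ext d
  rw [coeff_homogeneousComponent]
  by_cases h : Finsupp.single i 1 ≤ d
  · obtain ⟨e, rfl⟩ := exists_add_of_le h
    rw [X, coeff_add_monomial_mul, coeff_add_monomial_mul, coeff_pderiv, coeff_pderiv,
      coeff_homogeneousComponent]
    simp only [map_add, Finsupp.degree_single, add_comm]
    split_ifs <;> simp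
  · simp [X, coeff_monomial_mul, h]

/-! ### Bilinearity and order of the bracket -/

section Bracket

variable [Fintype ι]

/-- The bracket of a matrix as a bilinear map. -/
def bracketₗ (Ω : ι → ι → MvPowerSeries ι K) :
    MvPowerSeries ι K →ₗ[K] MvPowerSeries ι K →ₗ[K] MvPowerSeries ι K :=
  LinearMap.mk₂ K (bracket Ω)
    (fun _ _ _ => by simp [bracket, add_mul, Finset.sum_add_distrib])
    (fun _ _ _ => by simp [bracket, Finset.smul_sum])
    (fun _ _ _ => by simp [bracket, mul_add, Finset.sum_add_distrib])
    (fun _ _ _ => by simp [bracket, Finset.smul_sum])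

theorem bracketₗ_apply (Ω : ι → ι → MvPowerSeries ι K) (F G : MvPowerSeries ι K) :
    bracketₗ Ω F G = bracket Ω F G := rfl

theorem bracket_matrix_sub (Ω Ω' : ι → ι → MvPowerSeries ι K) (F G : MvPowerSeries ι K) :
    bracket (fun i j => Ω i j - Ω' i j) F G = bracket Ω F G - bracket Ω' F G := by
  simp [bracket, mul_sub, sub_mul, Finset.sum_sub_distrib]

/-- Each of the two derivatives lowers the order by one, and the matrix contributes k. -/
theorem bracket_mem_degreeGE {Ω : ι → ι → MvPowerSeries ι K} {k m n : ℕ}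
    (hΩ : ∀ i j, Ω i j ∈ degreeGE K ι k) {F G : MvPowerSeries ι K}
    (hF : F ∈ degreeGE K ι (m + 1)) (hG : G ∈ degreeGE K ι (n + 1)) :
    bracket Ω F G ∈ degreeGE K ι (m + k + n) :=
  Submodule.sum_mem _ fun i _ => Submodule.sum_mem _ fun j _ =>
    mul_mem_degreeGE (mul_mem_degreeGE (pderiv_mem_degreeGE hF i) (hΩ i j))
      (pderiv_mem_degreeGE hG j)

end Bracket

/-! ### Linear forms and the symmetric algebra inside power series -/

section LiePoisson

variable {L : Type*} [LieRing L] [LieAlgebra K L] (b : Module.Basis ι K L)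

@[elab_as_elim]
theorem basis_induction {motive : L → Prop} (x : L) (coe : ∀ i, motive (b i))
    (zero : motive 0) (add : ∀ x y, motive x → motive y → motive (x + y))
    (smul : ∀ (c : K) x, motive x → motive (c • x)) : motive x :=
  Submodule.span_induction (p := fun x _ => motive x) (by rintro _ ⟨i, rfl⟩; exact coe i) zero
    (fun x y _ _ => add x y) (fun c x _ => smul c x) (b.mem_span x)

/-- An element of the Lie algebra as a linear function on the dual space. -/
def linearForm : L →ₗ[K] MvPowerSeries ι K := b.constr K X

@[simp]
theorem linearForm_basis (i : ι) : linearForm b (b i) = X i := by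
  simp [linearForm]

theorem linearForm_mem_degreeGE (x : L) : linearForm b x ∈ degreeGE K ι 1 := by
  induction x using basis_induction b with
  | coe i =>
    intro d hd
    obtain rfl : d = 0 := (Finsupp.degree_eq_zero_iff d).1 (by omega)
    simp
  | zero => simp
  | add x y hx hy => simpa using add_mem hx hy
  | smul c x hx => simpa using Submodule.smul_mem _ c hx

theorem coeff_single_linearForm (x : L) (k : ι) :
    coeff (Finsupp.single k 1) (linearForm b x) = b.repr x k := by
  classical
  induction x using basis_induction b with
  | coe i => simp [coeff_X, Finsupp.single_apply, Finsupp.single_left_inj, eq_comm]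
  | zero => simp
  | add x y hx hy => simp [hx, hy]
  | smul c x hx => simp [hx]

/-- The inclusion of the symmetric algebra into the formal power series on the dual space. -/
def symmetricToPowerSeries : SymmetricAlgebra K L →ₐ[K] MvPowerSeries ι K :=
  (MvPolynomial.coeToMvPowerSeries.algHom K).comp
    (SymmetricAlgebra.equivMvPolynomial b).toAlgHom

theorem symmetricToPowerSeries_ι (x : L) :
    symmetricToPowerSeries b (SymmetricAlgebra.ι K L x) = linearForm b x := by
  induction x using basis_induction b with
  | coe i => simp [symmetricToPowerSeries]
  | zero => simp
  | add x y hx hy => simp [hx, hy]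
  | smul c x hx => simp [hx]

theorem symmetricToPowerSeries_injective : Function.Injective (symmetricToPowerSeries b) := by
  intro x y h
  apply (SymmetricAlgebra.equivMvPolynomial b).injective
  apply MvPolynomial.coe_injective
  simpa [symmetricToPowerSeries] using h

/-- A linear map close to `φ n` modulo terms of degree `n + 2`, for a coherent sequence `φ`. -/
theorem exists_limit (φ : ℕ → L →ₗ[K] MvPowerSeries ι K)
    (hφ : ∀ n x, φ (n + 1) x - φ n x ∈ degreeGE K ι (n + 2)) :
    ∃ f : L →ₗ[K] MvPowerSeries ι K, ∀ n x, f x - φ n x ∈ degreeGE K ι (n + 2) := by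
  -- Passing from φ n to φ (n + 1) changes only degrees ≥ n + 2, so coefficients of degree d are
  -- already final at stage d.
  let f : L →ₗ[K] MvPowerSeries ι K := LinearMap.pi fun d => coeff d ∘ₗ φ d.degree
  have hf (d : ι →₀ ℕ) (x : L) : coeff d (f x) = coeff d (φ d.degree x) := rfl
  have hle {m n : ℕ} (hmn : m ≤ n) (x : L) : φ n x - φ m x ∈ degreeGE K ι (m + 2) := by
    induction n, hmn using Nat.le_induction with
    | base => simp
    | succ n hmn ih =>
      simpa using add_mem (degreeGE_anti (by omega) (hφ n x)) ih
  refine ⟨f, fun n x d hd => ?_⟩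
  rw [map_sub, hf]
  rcases le_total d.degree n with h | h
  · have := hle h x d (by omega)
    rw [map_sub] at this
    rw [← neg_sub, this, neg_zero]
  · have := hle h x d hd
    rwa [map_sub] at this

variable {b} in
theorem HasLiePoissonLinearPart.mem_degreeGE {Ω : ι → ι → MvPowerSeries ι K}
    (hlin : HasLiePoissonLinearPart b Ω) (i j : ι) :
    Ω i j ∈ degreeGE K ι 1 := by
  intro d hd
  obtain rfl : d = 0 := (Finsupp.degree_eq_zero_iff d).1 (by omega)
  exact (hlin i j).1

variable {b} in
theorem HasLiePoissonLinearPart.sub_mem_degreeGE {Ω : ι → ι → MvPowerSeries ι K}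
    (hlin : HasLiePoissonLinearPart b Ω) (i j : ι) :
    Ω i j - linearForm b ⁅b i, b j⁆ ∈ degreeGE K ι 2 := by
  intro d hd
  rcases (show d.degree = 0 ∨ d.degree = 1 by omega) with h | h
  · exact sub_mem (hlin.mem_degreeGE i j) (linearForm_mem_degreeGE b _) d (by omega)
  · obtain ⟨k, rfl⟩ : d ∈ Set.range fun a : ι => Finsupp.single a 1 := by
      rwa [Finsupp.range_single_one]
    rw [map_sub, coeff_single_linearForm, (hlin i j).2 k, structureConstant, sub_self]

/-! ### The coadjoint action on power series -/

variable [Fintype ι]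

/-- The action of a Lie algebra element on formal power series on the dual space. -/
def coadjointDerivation (x : L) : Derivation K (MvPowerSeries ι K) (MvPowerSeries ι K) :=
  ∑ j, linearForm b ⁅x, b j⁆ • pderiv K j

theorem coadjointDerivation_apply (x : L) (F : MvPowerSeries ι K) :
    coadjointDerivation b x F = ∑ j, linearForm b ⁅x, b j⁆ * pderiv K j F := by
  rw [coadjointDerivation, ← Derivation.coeFnAddMonoidHom_apply, map_sum, Finset.sum_apply]
  rfl

theorem coadjointDerivation_linearForm (x y : L) :
    coadjointDerivation b x (linearForm b y) = linearForm b ⁅x, y⁆ := by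
  classical
  induction y using basis_induction b with
  | coe i => simp [coadjointDerivation_apply, pderiv_X, Pi.single_apply]
  | zero => simp
  | add y z hy hz => simp [hy, hz]
  | smul c y hy => simp [hy]

theorem bracket_linearForm (x : L) (G : MvPowerSeries ι K) :
    bracket (fun i j => linearForm b ⁅b i, b j⁆) (linearForm b x) G =
      coadjointDerivation b x G := by
  classical
  induction x using basis_induction b with
  | coe i => simp [bracket, coadjointDerivation_apply, pderiv_X, Pi.single_apply, ite_mul]
  | zero => simp [bracket, coadjointDerivation_apply]
  | add x y hx hy =>
    simp only [coadjointDerivation_apply, bracket] at hx hy ⊢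
    simp [add_mul, Finset.sum_add_distrib, hx, hy]
  | smul c x hx =>
    simp only [coadjointDerivation_apply, bracket] at hx ⊢
    simp [← Finset.smul_sum, hx]

/-- A vector field with linear coefficients preserves degree. -/
theorem homogeneousComponent_coadjointDerivation (n : ℕ) (x : L) (F : MvPowerSeries ι K) :
    homogeneousComponent n (coadjointDerivation b x F) =
      coadjointDerivation b x (homogeneousComponent n F) := by
  have h (z : L) (j : ι) : homogeneousComponent n (linearForm b z * pderiv K j F) =
      linearForm b z * pderiv K j (homogeneousComponent n F) := by
    induction z using basis_induction b with
    | coe i => simp [homogeneousComponent_X_mul_pderiv]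
    | zero => simp
    | add x y hx hy => simp [add_mul, hx, hy]
    | smul c x hx => simp [hx]
  simp [coadjointDerivation_apply, h]

theorem symmetricToPowerSeries_lie (x : L) (a : SymmetricAlgebra K L) :
    symmetricToPowerSeries b ⁅x, a⁆ = coadjointDerivation b x (symmetricToPowerSeries b a) := by
  rw [SymmetricAlgebra.lie_def]
  induction a using SymmetricAlgebra.induction with
  | algebraMap r => simp
  | ι y => simp [symmetricToPowerSeries_ι, coadjointDerivation_linearForm]
  | mul a c ha hc => simp [ha, hc]
  | add a c ha hc => simp [ha, hc]

/-- The homogeneous component of a power series as an element of the symmetric algebra. -/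
def symmetricComponent (n : ℕ) : MvPowerSeries ι K →ₗ[K] SymmetricAlgebra K L :=
  (SymmetricAlgebra.equivMvPolynomial b).symm.toLinearMap ∘ₗ truncTotal (n + 1) ∘ₗ
    homogeneousComponent n

theorem symmetricToPowerSeries_symmetricComponent (n : ℕ) (F : MvPowerSeries ι K) :
    symmetricToPowerSeries b (symmetricComponent b n F) = homogeneousComponent n F := by
  ext d
  simp only [symmetricComponent, symmetricToPowerSeries]
  simp [coeff_truncTotal_eq_ite, coeff_homogeneousComponent]
  omega

/-! ### Removing the defect -/

variable {b} {Ω : ι → ι → MvPowerSeries ι K}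

/-- The difference is the bracket of F - x with G, plus the bracket of x with G for Ω minus its
linear part. Each has one factor of order one higher than needed to preserve degree. -/
theorem HasLiePoissonLinearPart.bracket_sub_coadjointDerivation_mem
    (hlin : HasLiePoissonLinearPart b Ω) {F G : MvPowerSeries ι K} {n : ℕ} {x : L}
    (hF : F - linearForm b x ∈ degreeGE K ι 2) (hG : G ∈ degreeGE K ι (n + 1)) :
    bracket Ω F G - coadjointDerivation b x G ∈ degreeGE K ι (n + 2) := by
  have h₁ := bracket_mem_degreeGE hlin.mem_degreeGE hF hG
  have h₂ := bracket_mem_degreeGE hlin.sub_mem_degreeGE (linearForm_mem_degreeGE b x) hG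
  rw [bracket_matrix_sub, bracket_linearForm] at h₂
  rw [← bracketₗ_apply, map_sub, LinearMap.sub_apply, bracketₗ_apply, bracketₗ_apply] at h₁
  convert add_mem (degreeGE_anti (m := n + 2) (by omega) h₁)
    (degreeGE_anti (m := n + 2) (by omega) h₂) using 1
  abel

variable (Ω) in
/-- The failure of a linear map to be a homomorphism for the bracket. -/
def homDefect (φ : L →ₗ[K] MvPowerSeries ι K) : L →ₗ[K] L →ₗ[K] MvPowerSeries ι K :=
  (bracketₗ Ω).compl₁₂ φ φ - (LieModule.toEnd K L L : L →ₗ[K] L →ₗ[K] L).compr₂ φ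

theorem homDefect_apply (φ : L →ₗ[K] MvPowerSeries ι K) (x y : L) :
    homDefect Ω φ x y = bracket Ω (φ x) (φ y) - φ ⁅x, y⁆ := rfl

theorem IsPoissonMatrix.bracket_self [CharZero K] (hΩ : IsPoissonMatrix Ω)
    (F : MvPowerSeries ι K) : bracket Ω F F = 0 := by
  have h := hΩ.skew F F
  ext d
  have h' := congrArg (coeff d) h
  rw [map_neg, eq_neg_iff_add_eq_zero, ← two_mul] at h'
  simpa using h'

/-- This is the 2-cocycle identity with {φ x, ·} in place of the action of x; it combines the Jacobi
identities of the bracket and of L. -/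
theorem IsPoissonMatrix.homDefect_jacobi (hΩ : IsPoissonMatrix Ω)
    (φ : L →ₗ[K] MvPowerSeries ι K) (x y z : L) :
    bracket Ω (φ x) (homDefect Ω φ y z) - bracket Ω (φ y) (homDefect Ω φ x z) +
      bracket Ω (φ z) (homDefect Ω φ x y) - homDefect Ω φ ⁅x, y⁆ z + homDefect Ω φ ⁅x, z⁆ y -
      homDefect Ω φ ⁅y, z⁆ x = 0 := by
  have hs (F G H) : bracket Ω F (G - H) = bracket Ω F G - bracket Ω F H :=
    map_sub (bracketₗ Ω F) G H
  have h₁ : φ ⁅x, ⁅y, z⁆⁆ = φ ⁅⁅x, y⁆, z⁆ + φ ⁅y, ⁅x, z⁆⁆ := by rw [leibniz_lie, map_add]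
  have h₂ : φ ⁅⁅y, z⁆, x⁆ = -φ ⁅x, ⁅y, z⁆⁆ := by rw [← lie_skew, map_neg]
  have h₃ : φ ⁅⁅x, z⁆, y⁆ = -φ ⁅y, ⁅x, z⁆⁆ := by rw [← lie_skew, map_neg]
  simp only [homDefect_apply, hs, hΩ.jacobi (φ x) (φ y) (φ z), h₂, h₃, h₁]
  rw [hΩ.skew (φ z) (bracket _ _ _), hΩ.skew (φ z) (φ ⁅x, y⁆), hΩ.skew (φ ⁅x, z⁆),
    hΩ.skew (φ ⁅y, z⁆)]
  abel

/-- One step of the linearization: the defect of degree `n + 2` is removed by a correction of the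
same degree. -/
theorem exists_correction [CharZero K]
    (hH2 : Subsingleton (LieSecondCohomology K L (SymmetricAlgebra K L)))
    (hΩ : IsPoissonMatrix Ω) (hlin : HasLiePoissonLinearPart b Ω) (n : ℕ)
    (φ : L →ₗ[K] MvPowerSeries ι K) (hφ : ∀ x, φ x - linearForm b x ∈ degreeGE K ι 2)
    (hdef : ∀ x y, homDefect Ω φ x y ∈ degreeGE K ι (n + 2)) :
    ∃ φ' : L →ₗ[K] MvPowerSeries ι K, (∀ x, φ' x - φ x ∈ degreeGE K ι (n + 2)) ∧
      ∀ x y, homDefect Ω φ' x y ∈ degreeGE K ι (n + 3) := by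
  let c : LieModule.Cohomology.twoCochain K L (SymmetricAlgebra K L) :=
    ⟨(homDefect Ω φ).compr₂ (symmetricComponent b (n + 2)), fun x => by
      simp [homDefect_apply, hΩ.bracket_self]⟩
  have hcval (x y : L) : symmetricToPowerSeries b (c x y) =
      homogeneousComponent (n + 2) (homDefect Ω φ x y) :=
    symmetricToPowerSeries_symmetricComponent b _ _
  have hact (x y z : L) : homogeneousComponent (n + 2) (bracket Ω (φ x) (homDefect Ω φ y z)) =
      coadjointDerivation b x (homogeneousComponent (n + 2) (homDefect Ω φ y z)) := by
    rw [← homogeneousComponent_coadjointDerivation, ← sub_eq_zero, ← map_sub]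
    exact homogeneousComponent_eq_zero
      (hlin.bracket_sub_coadjointDerivation_mem (hφ x) (hdef y z))
  have hc : c ∈ LieModule.Cohomology.twoCocycle K L (SymmetricAlgebra K L) := by
    rw [LieModule.Cohomology.mem_twoCocycle_iff]
    ext x y z
    apply symmetricToPowerSeries_injective b
    have h := congrArg (homogeneousComponent (n + 2)) (hΩ.homDefect_jacobi φ x y z)
    simp only [map_add, map_sub, hact, map_zero] at h
    simpa [symmetricToPowerSeries_lie, hcval] using h
  -- The only use of the vanishing of H².
  obtain ⟨α, hα⟩ : c ∈ LinearMap.range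
      (LieModule.Cohomology.d₁₂ K L (SymmetricAlgebra K L)) := by
    have h := (Submodule.Quotient.mk_eq_zero _).1 (Subsingleton.elim (α :=
      LieSecondCohomology K L (SymmetricAlgebra K L)) (Submodule.Quotient.mk ⟨c, hc⟩) 0)
    exact h
  -- The primitive α need not be homogeneous. Its degree n + 2 part suffices, because the action
  -- preserves degree.
  let g : L →ₗ[K] MvPowerSeries ι K :=
    homogeneousComponent (n + 2) ∘ₗ (symmetricToPowerSeries b).toLinearMap ∘ₗ α
  have hg (x : L) : g x ∈ degreeGE K ι (n + 2) := homogeneousComponent_mem_degreeGE _ _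
  have hgdef (x y : L) : homogeneousComponent (n + 2) (homDefect Ω φ x y) =
      coadjointDerivation b x (g y) - coadjointDerivation b y (g x) - g ⁅x, y⁆ := by
    have h := congrArg (homogeneousComponent (n + 2)) (hcval x y)
    rw [← hα] at h
    have hidem (F : MvPowerSeries ι K) : homogeneousComponent (n + 2)
        (homogeneousComponent (n + 2) F) = homogeneousComponent (n + 2) F :=
      (isHomogeneous_iff_eq_homogeneousComponent.1 (isHomogeneous_homogeneousComponent F _)).symm
    simpa [hidem, symmetricToPowerSeries_lie, homogeneousComponent_coadjointDerivation, g,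
      eq_comm] using h
  refine ⟨φ - g, fun x => by simpa using hg x, fun x y => ?_⟩
  have h₁ := sub_homogeneousComponent_mem (hdef x y)
  have h₂ := hlin.bracket_sub_coadjointDerivation_mem (hφ x) (hg y)
  have h₃ := hlin.bracket_sub_coadjointDerivation_mem (hφ y) (hg x)
  -- The term quadratic in g has order at least 2n + 3 ≥ n + 3.
  have h₄ := degreeGE_anti (m := n + 3) (by omega)
    (bracket_mem_degreeGE hlin.mem_degreeGE (hg x) (hg y))
  have h : homDefect Ω (φ - g) x y =
      (homDefect Ω φ x y - homogeneousComponent (n + 2) (homDefect Ω φ x y)) -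
      (bracket Ω (φ x) (g y) - coadjointDerivation b x (g y)) +
      (bracket Ω (φ y) (g x) - coadjointDerivation b y (g x)) + bracket Ω (g x) (g y) := by
    rw [hgdef, homDefect_apply, homDefect_apply, hΩ.skew (φ y) (g x)]
    simp only [← bracketₗ_apply, map_sub, LinearMap.sub_apply]
    abel
  rw [h]
  exact add_mem (add_mem (sub_mem h₁ h₂) h₃) h₄

/-- If `H²(L, S(L))` vanishes, the coordinate functions can be corrected in degrees `≥ 2` so as
to generate a copy of `L` under the bracket. -/
theorem exists_homDefect_eq_zero [CharZero K]
    (hH2 : Subsingleton (LieSecondCohomology K L (SymmetricAlgebra K L)))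
    (hΩ : IsPoissonMatrix Ω) (hlin : HasLiePoissonLinearPart b Ω) :
    ∃ f : L →ₗ[K] MvPowerSeries ι K, (∀ x, f x - linearForm b x ∈ degreeGE K ι 2) ∧
      ∀ x y, homDefect Ω f x y = 0 := by
  let P (n : ℕ) (φ : L →ₗ[K] MvPowerSeries ι K) : Prop :=
    (∀ x, φ x - linearForm b x ∈ degreeGE K ι 2) ∧
      ∀ x y, homDefect Ω φ x y ∈ degreeGE K ι (n + 2)
  -- The implication makes the step total in φ, so that it can be chosen as a function and iterated.
  have hstep (n : ℕ) (φ : L →ₗ[K] MvPowerSeries ι K) : ∃ φ' : L →ₗ[K] MvPowerSeries ι K,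
      P n φ → P (n + 1) φ' ∧ ∀ x, φ' x - φ x ∈ degreeGE K ι (n + 2) := by
    by_cases h : P n φ
    · obtain ⟨φ', h₁, h₂⟩ := exists_correction hH2 hΩ hlin n φ h.1 h.2
      refine ⟨φ', fun _ => ⟨⟨fun x => ?_, h₂⟩, h₁⟩⟩
      simpa using add_mem (degreeGE_anti (by omega) (h₁ x)) (h.1 x)
    · exact ⟨φ, fun h' => absurd h' h⟩
  choose s hs using hstep
  let φ : ℕ → L →ₗ[K] MvPowerSeries ι K := fun n => Nat.rec (linearForm b) s n
  have hP (n : ℕ) : P n (φ n) := by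
    induction n with
    | zero =>
      refine ⟨fun x => by simp [φ], fun x y => ?_⟩
      have h := hlin.bracket_sub_coadjointDerivation_mem (F := linearForm b x) (x := x)
        (by simp) (linearForm_mem_degreeGE b y)
      rwa [coadjointDerivation_linearForm] at h
    | succ n ih => exact (hs n _ ih).1
  obtain ⟨f, hf⟩ := exists_limit φ fun n => (hs n _ (hP n)).2
  have hone (n : ℕ) (x : L) : φ n x ∈ degreeGE K ι 1 := by
    simpa using add_mem (degreeGE_anti (by omega) ((hP n).1 x)) (linearForm_mem_degreeGE b x)
  refine ⟨f, hf 0, fun x y => eq_zero_of_forall_mem_degreeGE fun n => ?_⟩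
  have hfone : f x ∈ degreeGE K ι 1 := by
    simpa using add_mem (degreeGE_anti (by omega) (hf n x)) (hone n x)
  have h₁ := bracket_mem_degreeGE hlin.mem_degreeGE hfone (hf n y)
  have h₂ := bracket_mem_degreeGE hlin.mem_degreeGE (hf n x) (hone n y)
  -- Replacing f by φ n costs only terms of order n + 2, so the defect of f has every order.
  have h : homDefect Ω f x y = homDefect Ω (φ n) x y + bracket Ω (f x) (f y - φ n y) +
      bracket Ω (f x - φ n x) (φ n y) - (f ⁅x, y⁆ - φ n ⁅x, y⁆) := by
    simp only [homDefect_apply, ← bracketₗ_apply, map_sub, LinearMap.sub_apply]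
    abel
  rw [h]
  exact degreeGE_anti (n := n + 2) (by omega) <| sub_mem (add_mem (add_mem ((hP n).2 x y)
    (degreeGE_anti (by omega) h₁)) (degreeGE_anti (by omega) h₂)) (hf n _)

end LiePoisson

end FormalPoisson

end

theorem mainTheorem11 {K L ι : Type*} [Field K] [CharZero K] [LieRing L] [LieAlgebra K L]
    [Fintype ι] [DecidableEq ι] (b : Module.Basis ι K L)
    (hH2 : Subsingleton (LieSecondCohomology K L (SymmetricAlgebra K L)))
    (Ω : ι → ι → MvPowerSeries ι K)
    (hΩ : FormalPoisson.IsPoissonMatrix Ω)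
    (hlin : FormalPoisson.HasLiePoissonLinearPart b Ω) :
    ∃ f : ι → MvPowerSeries ι K, FormalPoisson.IsFormalChangeOfVariables f ∧
      ∀ i j, FormalPoisson.bracket Ω (f i) (f j) =
        ∑ k, MvPowerSeries.C (FormalPoisson.structureConstant b i j k) * f k := by
  obtain ⟨f, hf, hdef⟩ := FormalPoisson.exists_homDefect_eq_zero hH2 hΩ hlin
  have hcoeff (i : ι) (d : ι →₀ ℕ) (hd : d.degree < 2) :
      MvPowerSeries.coeff d (f (b i)) = MvPowerSeries.coeff d (MvPowerSeries.X i) := by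
    have h := hf (b i) d hd
    rwa [map_sub, FormalPoisson.linearForm_basis, sub_eq_zero] at h
  refine ⟨fun i => f (b i), ⟨fun i => ?_, ?_⟩, fun i j => ?_⟩
  · simpa using hcoeff i 0 (by simp)
  -- Since f agrees with the coordinates below degree 2, the Jacobian at the origin is the identity.
  · convert isUnit_one using 1
    ext i j
    rw [Matrix.of_apply, hcoeff i _ (by simp)]
    simp [MvPowerSeries.coeff_X, Matrix.one_apply, Finsupp.single_left_inj, eq_comm]
  · have h := hdef (b i) (b j)
    rw [FormalPoisson.homDefect_apply, sub_eq_zero] at h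
    rw [h, ← b.sum_repr ⁅b i, b j⁆, map_sum]
    exact Finset.sum_congr rfl fun k _ => by
      rw [map_smul, MvPowerSeries.smul_eq_C_mul, FormalPoisson.structureConstant]
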